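/- **Theorem 3.14 (Weyl's Inequalities).** Let $S$ be a real symmetric positive definite $n\times n$ matrix and let $V\subset\mathbb R^n$ be an open set that is maximal among the subsets $D$ of $\mathbb R^n$ satisfying $y^tSx>0$ for all $y\in\overline{D}$, $y\ne 0$, and all $x\in D$; that is, $V$ is a domain of positivity with positive definite characteristic $S$. Assume that $V$ is homogeneous: for all $x,y\in V$ there is an invertible linear map $A$ with $A(V)=V$ and $Ax=y$. Let $V^*=\{x\in\mathbb R^n : x\cdot y>0 \text{ for every } y\in\overline V,\ y\neq 0\}$. For $C=V$ or $C=V^*$ let $\Delta_C(x)$ be the Lebesgue measure of $\{y : y\in C,\ x-y\in C\}$, for $x\in C$, and let $\sigma(C)=\max\{-1,\sigma_0(C)\}$, where $$\sigma_0(C)=\inf\Big\{\alpha\in\mathbb R : \int_{\{t\in C:\,|t|=1\}}\Delta_C^{\alpha}(t)\,dt<\infty\Big\}\in[-\infty,\infty)$$ and $dt$ is the surface measure on the unit sphere. Let $r\ge 1$ be real and, for measurable $f:V\to[0,\infty]$, let $$W_rf(x)=\frac1{\Gamma(r)}\int_{\{t\,:\,t-x\in V\}}\Delta_V^{r-1}(t-x)f(t)\,dt,\qquad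 x\in V.$$ For $1\le p<\infty$ let $1/p'=1-1/p$. In each of the following three statements, $c<\infty$ is a constant that does not depend on $f$, the inequality holds for all measurable $f:V\to[0,\infty]$, and both of its sides may be infinite. 1. If $1\le p\le q<\infty$ and $\gamma>\sigma(V)+\sigma(V^*)\,q/p'+2q-q/p$, then $$\left(\int_V\Delta_V^{\gamma-q}(x)\,(W_rf(x))^q\,dx\right)^{1/q}\le c\left(\int_V f^p(x)\,\Delta_V^{(r-1)p+(\gamma+1)p/q-1}(x)\,dx\right)^{1/p}.$$ 2. If $1\le p<\infty$ and $\alpha>\sigma(V^*)/p'+2-1/p$, then $$\operatorname*{ess\,sup}_{x\in V}\left(\Delta_V^{-1+\alpha}(x)\,W_r(f\Delta_V^{-\alpha})(x)\right)\le c\left(\int_V f^p(x)\,\Delta_V^{(r-1)p-1}(x)\,dx\right)^{1/p}.$$ 3. If $\alpha>2+\sigma(V^*)$, then $$\operatorname*{ess\,sup}_{x\in V}\left(\Delta_V^{-1+\alpha}(x)\,W_r(f\Delta_V^{-\alpha})(x)\right)\le c\,\operatorname*{ess\,sup}_{x\in V}\left(f(x)\,\Delta_V^{r-1}(x)\right).$$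 -/

import Mathlib

open MeasureTheory Metric
open scoped ENNReal NNReal Matrix

/-- The Euclidean space `ℝⁿ`. -/
abbrev Rn (n : ℕ) : Type := EuclideanSpace ℝ (Fin n)

/-- The symmetric non-singular matrix `S` is a characteristic of the open set `D ⊆ ℝⁿ`, that is, `D`
is a domain of positivity with characteristic `S`: `D` is a maximal set (for inclusion, among all
subsets of `ℝⁿ`) such that `yᵗ S x > 0` for all `y ∈ closure D`, `y ≠ 0`, and all `x ∈ D`.
Openness only excludes the degenerate maximal set `{0}` (when `0 < n`). -/
structure IsCharacteristic {n : ℕ} (S : Matrix (Fin n) (Fin n) ℝ) (D : Set (Rn n)) : Prop where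
  isOpen : IsOpen D
  isSymm : S.IsSymm
  isUnit_det : IsUnit S.det
  maximal : Maximal (fun D' : Set (Rn n) =>
    ∀ y ∈ closure D', y ≠ 0 → ∀ x ∈ D', 0 < WithLp.ofLp y ⬝ᵥ S *ᵥ WithLp.ofLp x) D

/-- `V` is homogeneous: the group of invertible linear maps sending `V` onto `V` acts transitively
on `V`. -/
def IsHomogeneousSet {n : ℕ} (V : Set (Rn n)) : Prop :=
  ∀ x ∈ V, ∀ y ∈ V, ∃ A : Rn n ≃L[ℝ] Rn n, A '' V = V ∧ A x = y

/-- The dual `V* = {x : x · y > 0 for every y ∈ closure V, y ≠ 0}`. -/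
def dualCone {n : ℕ} (V : Set (Rn n)) : Set (Rn n) :=
  {x | ∀ y ∈ closure V, y ≠ 0 → 0 < inner ℝ x y}

/-- The strict order of the cone `V`: `x <_V y` if and only if `y - x ∈ V`. -/
def coneLT {n : ℕ} (V : Set (Rn n)) (x y : Rn n) : Prop := y - x ∈ V

/-- The cone interval `⟨a, b⟩ = {x : a <_V x <_V b}` (a subset of the cone if `a` is `0` or lies in
the cone). -/
def coneInterval {n : ℕ} (V : Set (Rn n)) (a b : Rn n) : Set (Rn n) :=
  {x | coneLT V a x ∧ coneLT V x b}

/-- The unbounded cone interval `⟨a, ∞⟩ = {x : a <_V x}`. -/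
def coneIntervalTop {n : ℕ} (V : Set (Rn n)) (a : Rn n) : Set (Rn n) :=
  {x | coneLT V a x}

/-- `Δ_V(x)`, the Lebesgue measure of the cone interval `⟨0, x⟩`. It is used for `x` in the cone `V`
only, where it is positive and finite. -/
noncomputable def coneDelta {n : ℕ} (V : Set (Rn n)) (x : Rn n) : ℝ≥0∞ :=
  volume (coneInterval V 0 x)

/-- `σ₀(V) = inf {α ∈ ℝ : ∫_{Σ_V} Δ_V^α(t) dt < ∞}`, where `Σ_V` is the intersection of `V` with the
unit sphere and `dt` is the surface measure. The infimum may be `-∞` (as it is for `n = 1`). -/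
noncomputable def coneSigma0 {n : ℕ} (V : Set (Rn n)) : EReal :=
  sInf ((fun α : ℝ => (α : EReal)) ''
    {α : ℝ | ∫⁻ t in {t : sphere (0 : Rn n) 1 | (t : Rn n) ∈ V}, coneDelta V (t : Rn n) ^ α
      ∂(volume : Measure (Rn n)).toSphere < ∞})

/-- `σ(V) = max {-1, σ₀(V)}`; for a cone `V` one has `σ₀(V) ≤ 0`, so that this is a real number. -/
noncomputable def coneSigma {n : ℕ} (V : Set (Rn n)) : ℝ :=
  (max (-1 : EReal) (coneSigma0 V)).toReal

/-- The Weyl fractional integral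
`W_r f(x) = Γ(r)⁻¹ ∫_{⟨x, ∞⟩} Δ_V^{r-1}(t - x) f(t) dt` of a non-negative function. -/
noncomputable def weylOp {n : ℕ} (V : Set (Rn n)) (r : ℝ) (f : Rn n → ℝ≥0∞) (x : Rn n) : ℝ≥0∞ :=
  ENNReal.ofReal (1 / Real.Gamma r) *
    ∫⁻ t in coneIntervalTop V x, coneDelta V (t - x) ^ (r - 1) * f t

/-! ### Linear changes of variables -/

/-! Maximality and the symmetric positive definite form `S` make `V` an open convex cone with `V* =
S V`. Hence `V` and `V*` are both homogeneous, each under maps whose adjoints preserve the other.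
Write `C` and `D` for such a pair and `Δ` for `coneDelta`.

An automorphism `A` of `C` multiplies `Δ_C` by `|det A|`, so transitivity determines many integrals
up to a constant. The Laplace transform of `Δ_D^α` is a constant times `Δ_C^{-(1+α)}` once it is
finite, and for `α > σ(D)` finiteness follows in polar coordinates (`coneLaplace_mul_rpow_eq`,
`lintegral_rpow_exp_norm_ne_top`). This yields two power integrals: `∫_{⟨0,t⟩} Δ^s ≤ K Δ(t)^{s+1}`
for `s > σ(C)`, and `∫_{⟨x,∞⟩} Δ^{-β} ≤ K Δ(x)^{1-β}` for `β > 2 + σ(D)`.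

As `r ≥ 1` and `Δ` is monotone, the kernel `Δ^{r-1}(t - x)` may be replaced by `Δ^{r-1}(t)`. The
third inequality is then the second power integral, and the second inequality adds Hölder. For the
first, a Schur-type weight `Δ^a` is inserted before Hölder, the power `q/p` is moved inside by a
second Hölder step, and Tonelli with the first power integral finishes. The condition on `γ` says
exactly that an admissible `a` exists. -/

theorem setLIntegral_image_continuousLinearEquiv {n : ℕ} (A : Rn n ≃L[ℝ] Rn n) {s : Set (Rn n)}
    (hs : MeasurableSet s) (f : Rn n → ℝ≥0∞) :
    ∫⁻ x in A '' s, f x =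
      ENNReal.ofReal |LinearMap.det (A : Rn n →ₗ[ℝ] Rn n)| * ∫⁻ x in s, f (A x) := by
  rw [← lintegral_const_mul' _ _ ENNReal.ofReal_ne_top]
  exact lintegral_image_eq_lintegral_abs_det_fderiv_mul volume hs
    (fun x _ => (A : Rn n →L[ℝ] Rn n).hasFDerivAt.hasFDerivWithinAt) A.injective.injOn f

theorem ofReal_abs_det_ne_zero {n : ℕ} (A : Rn n ≃L[ℝ] Rn n) :
    ENNReal.ofReal |LinearMap.det (A : Rn n →ₗ[ℝ] Rn n)| ≠ 0 := by
  have h : LinearMap.det (A : Rn n →ₗ[ℝ] Rn n) ≠ 0 :=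
    (LinearEquiv.isUnit_det' A.toLinearEquiv).ne_zero
  simpa using h

theorem det_eq_of_inner_eq {n : ℕ} {A B : Rn n ≃L[ℝ] Rn n}
    (h : ∀ x y, inner ℝ (A x) y = inner ℝ x (B y)) :
    LinearMap.det (A : Rn n →ₗ[ℝ] Rn n) = LinearMap.det (B : Rn n →ₗ[ℝ] Rn n) := by
  have hB : (B : Rn n →ₗ[ℝ] Rn n) = LinearMap.adjoint (A : Rn n →ₗ[ℝ] Rn n) := by
    rw [LinearMap.eq_adjoint_iff]
    intro x y
    rw [real_inner_comm, ← real_inner_comm x]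
    exact (h y x).symm
  let v := EuclideanSpace.basisFun (Fin n) ℝ
  rw [hB, ← LinearMap.det_toMatrix v.toBasis, ← LinearMap.det_toMatrix v.toBasis,
    LinearMap.toMatrix_adjoint, Matrix.det_conjTranspose]
  simp

theorem exists_inner_adjoint_equiv {n : ℕ} (A : Rn n ≃L[ℝ] Rn n) :
    ∃ B : Rn n ≃L[ℝ] Rn n, ∀ x y, inner ℝ (A x) y = inner ℝ x (B y) := by
  let T := LinearMap.adjoint (A : Rn n →ₗ[ℝ] Rn n)
  have hT : ∀ x y, inner ℝ (A x) y = inner ℝ x (T y) := fun x y =>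
    (LinearMap.adjoint_inner_right (A : Rn n →ₗ[ℝ] Rn n) x y).symm
  have hinj : Function.Injective T := by
    rw [injective_iff_map_eq_zero]
    intro y hy
    have := hT (A.symm y) y
    simpa [hy] using this
  exact ⟨(LinearEquiv.ofInjectiveEndo T hinj).toContinuousLinearEquiv, hT⟩

/-! ### The volume of cone intervals -/

theorem measurable_coneDelta {n : ℕ} {C : Set (Rn n)} (hC : IsOpen C) :
    Measurable (coneDelta C) := by
  have h : MeasurableSet {z : Rn n × Rn n | z.2 ∈ C ∧ z.1 - z.2 ∈ C} :=
    ((hC.preimage continuous_snd).inter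
      (hC.preimage (continuous_fst.sub continuous_snd))).measurableSet
  convert measurable_measure_prodMk_left (ν := (volume : Measure (Rn n))) h using 2 with x
  simp [coneDelta, coneInterval, coneLT]

theorem coneInterval_map {n : ℕ} {C : Set (Rn n)} {A : Rn n ≃L[ℝ] Rn n} (hA : A '' C = C)
    (x : Rn n) : coneInterval C 0 (A x) = A '' coneInterval C 0 x := by
  have hmem : ∀ z, A z ∈ C ↔ z ∈ C := fun z => by
    conv_lhs => rw [← hA]
    exact A.injective.mem_set_image
  ext y
  obtain ⟨z, rfl⟩ := A.surjective y
  rw [A.injective.mem_set_image]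
  simp only [coneInterval, coneLT, Set.mem_ofPred_eq, sub_zero, ← map_sub, hmem]

theorem coneDelta_map {n : ℕ} {C : Set (Rn n)} {A : Rn n ≃L[ℝ] Rn n} (hA : A '' C = C)
    (x : Rn n) : coneDelta C (A x) =
      ENNReal.ofReal |LinearMap.det (A : Rn n →ₗ[ℝ] Rn n)| * coneDelta C x := by
  rw [coneDelta, coneInterval_map hA, Measure.addHaar_image_continuousLinearEquiv, coneDelta]

/-- `C` and `D` are open convex cones in duality, each of them homogeneous under linear maps whose
adjoints preserve the other one. -/
structure IsDualConePair {n : ℕ} (C D : Set (Rn n)) : Prop where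
  isOpen_left : IsOpen C
  isOpen_right : IsOpen D
  nonempty_left : C.Nonempty
  nonempty_right : D.Nonempty
  add_left : ∀ x ∈ C, ∀ y ∈ C, x + y ∈ C
  add_right : ∀ x ∈ D, ∀ y ∈ D, x + y ∈ D
  smul_left : ∀ c : ℝ, 0 < c → ∀ x ∈ C, c • x ∈ C
  smul_right : ∀ c : ℝ, 0 < c → ∀ x ∈ D, c • x ∈ D
  inner_nonneg : ∀ x ∈ C, ∀ y ∈ D, 0 ≤ inner ℝ x y
  trans_left : ∀ x ∈ C, ∀ x' ∈ C, ∃ A B : Rn n ≃L[ℝ] Rn n, A '' C = C ∧ B '' D = D ∧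
    (∀ x y, inner ℝ (A x) y = inner ℝ x (B y)) ∧ A x = x'
  trans_right : ∀ y ∈ D, ∀ y' ∈ D, ∃ A B : Rn n ≃L[ℝ] Rn n, A '' D = D ∧ B '' C = C ∧
    (∀ x y, inner ℝ (A x) y = inner ℝ x (B y)) ∧ A y = y'

/-! ### Geometry and volume function of cones in duality -/

namespace IsDualConePair

variable {n : ℕ} {C D : Set (Rn n)}

theorem symm (h : IsDualConePair C D) : IsDualConePair D C where
  isOpen_left := h.isOpen_right
  isOpen_right := h.isOpen_left
  nonempty_left := h.nonempty_right
  nonempty_right := h.nonempty_left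
  add_left := h.add_right
  add_right := h.add_left
  smul_left := h.smul_right
  smul_right := h.smul_left
  inner_nonneg x hx y hy := by rw [real_inner_comm]; exact h.inner_nonneg y hy x hx
  trans_left := h.trans_right
  trans_right := h.trans_left

theorem measurableSet_left (h : IsDualConePair C D) : MeasurableSet C := h.isOpen_left.measurableSet

/-- Openness leaves room to subtract from `x` a multiple of `y` of length `δ/2`; pairing the result
with `y` still gives a nonnegative number. -/
theorem exists_norm_le_inner (h : IsDualConePair C D) {x : Rn n} (hx : x ∈ C) :
    ∃ ε > 0, ∀ y ∈ D, ε * ‖y‖ ≤ inner ℝ x y := by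
  obtain ⟨δ, hδ, hball⟩ := Metric.isOpen_iff.1 h.isOpen_left x hx
  refine ⟨δ / 2, by positivity, fun y hy => ?_⟩
  rcases eq_or_ne y 0 with rfl | hy0
  · simp
  have hy1 : 0 < ‖y‖ := norm_pos_iff.2 hy0
  have hmem : x - (δ / 2 / ‖y‖) • y ∈ C := by
    apply hball
    rw [mem_ball, dist_eq_norm, sub_sub_cancel_left, norm_neg, norm_smul, Real.norm_of_nonneg
      (by positivity), div_mul_cancel₀ _ hy1.ne']
    linarith
  have := h.inner_nonneg _ hmem y hy
  rw [inner_sub_left, real_inner_smul_left, real_inner_self_eq_norm_sq] at this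
  have h2 : δ / 2 / ‖y‖ * ‖y‖ ^ 2 = δ / 2 * ‖y‖ := by field_simp
  linarith

/-- For a fixed `w` in the dual cone, `ε‖y‖ ≤ w·y ≤ w·x ≤ ‖w‖‖x‖` whenever `y` lies in `⟨0, x⟩`. -/
theorem exists_coneInterval_subset_ball (h : IsDualConePair C D) :
    ∃ R : ℝ, 0 < R ∧ ∀ x, coneInterval C 0 x ⊆ closedBall 0 (R * ‖x‖) := by
  obtain ⟨w, hw⟩ := h.nonempty_right
  obtain ⟨ε, hε, hle⟩ := h.symm.exists_norm_le_inner hw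
  refine ⟨(‖w‖ + 1) / ε, by positivity, fun x y hy => ?_⟩
  obtain ⟨hy, hxy⟩ := hy
  rw [coneLT, sub_zero] at hy
  rw [mem_closedBall_zero_iff, div_mul_eq_mul_div, le_div_iff₀ hε]
  have h1 := hle y hy
  have h2 := h.symm.inner_nonneg w hw _ hxy
  rw [inner_sub_right] at h2
  have h3 := real_inner_le_norm w x
  nlinarith [norm_nonneg x]

theorem coneDelta_ne_top (h : IsDualConePair C D) (x : Rn n) : coneDelta C x ≠ ⊤ := by
  obtain ⟨R, -, hR⟩ := h.exists_coneInterval_subset_ball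
  exact ((measure_mono (hR x)).trans_lt measure_closedBall_lt_top).ne

theorem exists_coneDelta_le (h : IsDualConePair C D) :
    ∃ M : ℝ≥0∞, M ≠ ⊤ ∧ ∀ x, ‖x‖ ≤ 1 → coneDelta C x ≤ M := by
  obtain ⟨R, hR0, hR⟩ := h.exists_coneInterval_subset_ball
  refine ⟨volume (closedBall (0 : Rn n) R), measure_closedBall_lt_top.ne, fun x hx => ?_⟩
  refine measure_mono ((hR x).trans (closedBall_subset_closedBall ?_))
  nlinarith

theorem coneDelta_ne_zero (h : IsDualConePair C D) {x : Rn n} (hx : x ∈ C) :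
    coneDelta C x ≠ 0 := by
  have hopen : IsOpen (coneInterval C 0 x) :=
    (h.isOpen_left.preimage (continuous_id.sub continuous_const)).inter
      (h.isOpen_left.preimage (continuous_const.sub continuous_id))
  refine hopen.measure_ne_zero _ ⟨(1 / 2 : ℝ) • x, ?_, ?_⟩
  · rw [coneLT, sub_zero]
    exact h.smul_left _ (by norm_num) x hx
  · have : x - (1 / 2 : ℝ) • x = (1 / 2 : ℝ) • x := by module
    rw [coneLT, this]
    exact h.smul_left _ (by norm_num) x hx

theorem coneDelta_mono (h : IsDualConePair C D) {x y : Rn n} (hxy : y - x ∈ C) :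
    coneDelta C x ≤ coneDelta C y := by
  refine measure_mono fun z hz => ⟨hz.1, ?_⟩
  have := h.add_left _ hxy _ hz.2
  rw [coneLT]
  convert this using 1
  abel

theorem image_smul (h : IsDualConePair C D) {c : ℝ} (hc : 0 < c) :
    (ContinuousLinearEquiv.smulLeft (Units.mk0 c hc.ne') : Rn n ≃L[ℝ] Rn n) '' C = C := by
  ext y
  constructor
  · rintro ⟨x, hx, rfl⟩
    exact h.smul_left c hc x hx
  · intro hy
    exact ⟨c⁻¹ • y, h.smul_left _ (inv_pos.2 hc) y hy, smul_inv_smul₀ hc.ne' y⟩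

theorem coneDelta_smul (h : IsDualConePair C D) {c : ℝ} (hc : 0 < c) (x : Rn n) :
    coneDelta C (c • x) = ENNReal.ofReal (c ^ n) * coneDelta C x := by
  have h1 := coneDelta_map (h.image_smul hc) x
  have h2 : ((ContinuousLinearEquiv.smulLeft (Units.mk0 c hc.ne') : Rn n ≃L[ℝ] Rn n) :
      Rn n →ₗ[ℝ] Rn n) = c • LinearMap.id := rfl
  have h3 : (ContinuousLinearEquiv.smulLeft (Units.mk0 c hc.ne') : Rn n ≃L[ℝ] Rn n) x = c • x := rfl
  rw [h2, h3, LinearMap.det_smul] at h1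
  rw [h1]
  simp [abs_of_pos hc]

end IsDualConePair

/-! ### Laplace transforms of powers of the volume function -/

/-- The Laplace transform `∫_D Δ_D^α(y) e^{-t·y} dy`. -/
noncomputable def coneLaplace {n : ℕ} (D : Set (Rn n)) (α : ℝ) (t : Rn n) : ℝ≥0∞ :=
  ∫⁻ y in D, coneDelta D y ^ α * ENNReal.ofReal (Real.exp (-inner ℝ t y))

theorem lintegral_volumeIoiPow_exp_ne_top (m : ℕ) {s ε : ℝ} (hs : -1 < m + s) (hε : 0 < ε) :
    ∫⁻ ρ : Set.Ioi (0 : ℝ), ENNReal.ofReal (ρ.1 ^ s * Real.exp (-ε * ρ.1))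
      ∂(Measure.volumeIoiPow m) ≠ ⊤ := by
  have hmeas : Measurable fun ρ : Set.Ioi (0 : ℝ) =>
      ENNReal.ofReal (ρ.1 ^ s * Real.exp (-ε * ρ.1)) := by fun_prop
  rw [Measure.volumeIoiPow, lintegral_withDensity_eq_lintegral_mul _ (by fun_prop) hmeas]
  have hint := (integrableOn_rpow_mul_exp_neg_mul_rpow hs one_pos hε).lintegral_lt_top
  refine ne_of_lt (lt_of_eq_of_lt ?_ hint)
  rw [← lintegral_subtype_comap measurableSet_Ioi]
  refine lintegral_congr fun ρ => ?_
  have hρ : (0 : ℝ) < ρ.1 := ρ.2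
  simp only [Pi.mul_apply]
  rw [← ENNReal.ofReal_mul (by positivity), ← mul_assoc, Real.rpow_one, Real.rpow_add hρ,
    Real.rpow_natCast]

namespace IsDualConePair

variable {n : ℕ} {C D : Set (Rn n)}

theorem coneDelta_smul_rpow (h : IsDualConePair C D) {c : ℝ} (hc : 0 < c) (x : Rn n) (α : ℝ) :
    coneDelta C (c • x) ^ α = ENNReal.ofReal (c ^ (n * α)) * coneDelta C x ^ α := by
  rw [h.coneDelta_smul hc, ENNReal.mul_rpow_of_ne_top ENNReal.ofReal_ne_top (h.coneDelta_ne_top x),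
    ENNReal.ofReal_rpow_of_pos (by positivity), ← Real.rpow_natCast, ← Real.rpow_mul hc.le]

/-- Since `Δ` is bounded on the unit sphere, the admissible exponents form an up-set, so every
exponent above the infimum `σ₀` is admissible. -/
theorem lintegral_sphere_mono_exponent (h : IsDualConePair C D) {α₀ α : ℝ} (hα : α₀ ≤ α)
    (hint : ∫⁻ t in {t : sphere (0 : Rn n) 1 | (t : Rn n) ∈ C}, coneDelta C (t : Rn n) ^ α₀
      ∂(volume : Measure (Rn n)).toSphere < ∞) :
    ∫⁻ t in {t : sphere (0 : Rn n) 1 | (t : Rn n) ∈ C}, coneDelta C (t : Rn n) ^ α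
      ∂(volume : Measure (Rn n)).toSphere < ∞ := by
  obtain ⟨M, hM, hle⟩ := h.exists_coneDelta_le
  have hms : MeasurableSet {t : sphere (0 : Rn n) 1 | (t : Rn n) ∈ C} :=
    measurable_subtype_coe h.measurableSet_left
  calc _ ≤ ∫⁻ t in {t : sphere (0 : Rn n) 1 | (t : Rn n) ∈ C},
          coneDelta C (t : Rn n) ^ α₀ * M ^ (α - α₀) ∂(volume : Measure (Rn n)).toSphere := by
        refine setLIntegral_mono' hms fun t ht => ?_
        calc coneDelta C (t : Rn n) ^ α = coneDelta C (t : Rn n) ^ α₀ *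
              coneDelta C (t : Rn n) ^ (α - α₀) := by
              rw [← ENNReal.rpow_add _ _ (h.coneDelta_ne_zero ht) (h.coneDelta_ne_top _)]
              congr 1
              ring
          _ ≤ _ := by
              gcongr
              exact hle _ (by simp)
    _ = (∫⁻ t in {t : sphere (0 : Rn n) 1 | (t : Rn n) ∈ C}, coneDelta C (t : Rn n) ^ α₀
          ∂(volume : Measure (Rn n)).toSphere) * M ^ (α - α₀) :=
        lintegral_mul_const' _ _ (ENNReal.rpow_ne_top_of_nonneg (by linarith) hM)
    _ < ∞ := ENNReal.mul_lt_top hint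
        (ENNReal.rpow_ne_top_of_nonneg (by linarith) hM).lt_top

/-- `Δ` is homogeneous of degree `n`, so in polar coordinates the integral is the product of the
spherical integral and `∫ ρ^{nα+n-1} e^{-ερ} dρ`. The latter converges because `α > -1`. -/
theorem lintegral_rpow_exp_norm_ne_top (h : IsDualConePair C D) {α ε : ℝ} (hε : 0 < ε)
    (hα : -1 < α)
    (hint : ∫⁻ t in {t : sphere (0 : Rn n) 1 | (t : Rn n) ∈ C}, coneDelta C (t : Rn n) ^ α
      ∂(volume : Measure (Rn n)).toSphere < ∞) :
    ∫⁻ x in C, coneDelta C x ^ α * ENNReal.ofReal (Real.exp (-ε * ‖x‖)) ≠ ⊤ := by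
  -- Polar coordinates need a nontrivial space; for `n = 0` the integral is over a single point.
  rcases Nat.eq_zero_or_pos n with rfl | hn
  · obtain ⟨x₀, hx₀⟩ := h.nonempty_left
    have hfun : ∀ x, coneDelta C x ^ α * ENNReal.ofReal (Real.exp (-ε * ‖x‖)) =
        coneDelta C x₀ ^ α * ENNReal.ofReal (Real.exp (-ε * ‖x₀‖)) := fun x => by
      rw [Subsingleton.elim x x₀]
    simp_rw [hfun]
    rw [setLIntegral_const]
    refine ENNReal.mul_ne_top (ENNReal.mul_ne_top ?_ ENNReal.ofReal_ne_top) ?_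
    · exact ENNReal.rpow_ne_top_of_ne_zero (h.coneDelta_ne_zero hx₀) (h.coneDelta_ne_top _)
    · exact (Set.Finite.isCompact (Set.toFinite C)).measure_lt_top.ne
  have : Nonempty (Fin n) := ⟨⟨0, hn⟩⟩
  have hms : MeasurableSet {t : sphere (0 : Rn n) 1 | (t : Rn n) ∈ C} :=
    measurable_subtype_coe h.measurableSet_left
  have hmemsmul : ∀ c : ℝ, 0 < c → ∀ x, c • x ∈ C ↔ x ∈ C := fun c hc x =>
    ⟨fun hx => by simpa [smul_smul, hc.ne'] using h.smul_left c⁻¹ (inv_pos.2 hc) _ hx,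
      h.smul_left c hc x⟩
  have hF : ∀ x : ({0}ᶜ : Set (Rn n)),
      C.indicator (fun x => coneDelta C x ^ α * ENNReal.ofReal (Real.exp (-ε * ‖x‖))) (x : Rn n) =
      {t : sphere (0 : Rn n) 1 | (t : Rn n) ∈ C}.indicator (fun t => coneDelta C (t : Rn n) ^ α)
        (homeomorphUnitSphereProd (Rn n) x).1 *
      ENNReal.ofReal ((homeomorphUnitSphereProd (Rn n) x).2.1 ^ (n * α) *
        Real.exp (-ε * (homeomorphUnitSphereProd (Rn n) x).2.1)) := by
    intro x
    have hx : 0 < ‖(x : Rn n)‖ := norm_pos_iff.2 x.2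
    have hx' : (x : Rn n) = ‖(x : Rn n)‖ • (‖(x : Rn n)‖⁻¹ • (x : Rn n)) := by
      rw [smul_inv_smul₀ hx.ne']
    by_cases hxC : (x : Rn n) ∈ C
    · rw [Set.indicator_of_mem hxC, Set.indicator_of_mem]
      · simp only [homeomorphUnitSphereProd_apply_fst_coe, homeomorphUnitSphereProd_apply_snd_coe]
        rw [hx', h.coneDelta_smul_rpow hx, ← hx', ENNReal.ofReal_mul (by positivity)]
        ring
      · simpa [hmemsmul _ (inv_pos.2 hx)] using hxC
    · rw [Set.indicator_of_notMem hxC, Set.indicator_of_notMem, zero_mul]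
      simpa [hmemsmul _ (inv_pos.2 hx)] using hxC
  rw [← lintegral_indicator h.measurableSet_left, ← restrict_compl_singleton (μ := volume) 0,
    ← lintegral_subtype_comap (measurableSet_singleton _).compl]
  simp_rw [hF]
  have hmp := (volume : Measure (Rn n)).measurePreserving_homeomorphUnitSphereProd
  have hm1 : Measurable ({t : sphere (0 : Rn n) 1 | (t : Rn n) ∈ C}.indicator
      fun t => coneDelta C (t : Rn n) ^ α) :=
    (((measurable_coneDelta h.isOpen_left).comp measurable_subtype_coe).pow_const α).indicator hms
  have hm2 : Measurable fun ρ : Set.Ioi (0 : ℝ) =>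
      ENNReal.ofReal (ρ.1 ^ (n * α) * Real.exp (-ε * ρ.1)) := by fun_prop
  rw [hmp.lintegral_comp_emb (Homeomorph.measurableEmbedding _)
    (fun z : sphere (0 : Rn n) 1 × Set.Ioi (0 : ℝ) =>
      {t : sphere (0 : Rn n) 1 | (t : Rn n) ∈ C}.indicator (fun t => coneDelta C (t : Rn n) ^ α)
        z.1 * ENNReal.ofReal (z.2.1 ^ (n * α) * Real.exp (-ε * z.2.1))),
    lintegral_prod_mul hm1.aemeasurable hm2.aemeasurable, lintegral_indicator hms]
  refine ENNReal.mul_ne_top hint.ne (lintegral_volumeIoiPow_exp_ne_top _ ?_ hε)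
  have hn' : (0 : ℝ) < n := by exact_mod_cast hn
  rw [finrank_euclideanSpace_fin, Nat.cast_pred hn]
  nlinarith

theorem coneLaplace_ne_top (h : IsDualConePair C D) {α : ℝ} (hα : -1 < α)
    (hint : ∫⁻ t in {t : sphere (0 : Rn n) 1 | (t : Rn n) ∈ D}, coneDelta D (t : Rn n) ^ α
      ∂(volume : Measure (Rn n)).toSphere < ∞) {t : Rn n} (ht : t ∈ C) :
    coneLaplace D α t ≠ ⊤ := by
  obtain ⟨ε, hε, hle⟩ := h.exists_norm_le_inner ht
  refine ne_top_of_le_ne_top (h.symm.lintegral_rpow_exp_norm_ne_top hε hα hint) ?_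
  refine setLIntegral_mono' h.symm.measurableSet_left fun y hy => ?_
  gcongr
  linarith [hle y hy]

/-- The exponent `0` is always admissible because the sphere has finite measure. Hence `σ₀ ≤ 0`, and
the `toReal` in `coneSigma` is never taken at `⊤`. -/
theorem lintegral_sphere_zero_lt_top (C : Set (Rn n)) :
    ∫⁻ t in {t : sphere (0 : Rn n) 1 | (t : Rn n) ∈ C}, coneDelta C (t : Rn n) ^ (0 : ℝ)
      ∂(volume : Measure (Rn n)).toSphere < ∞ := by
  simp

theorem neg_one_le_coneSigma (C : Set (Rn n)) : -1 ≤ coneSigma C := by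
  have htop : max (-1 : EReal) (coneSigma0 C) ≠ ⊤ := by
    have h0 : coneSigma0 C ≤ ((0 : ℝ) : EReal) :=
      sInf_le ⟨0, lintegral_sphere_zero_lt_top C, rfl⟩
    refine ne_of_lt (max_lt (by exact EReal.coe_lt_top (-1)) (h0.trans_lt (EReal.coe_lt_top 0)))
  have h1 : ((-1 : ℝ) : EReal) ≤ max (-1 : EReal) (coneSigma0 C) := le_max_left _ _
  have := EReal.toReal_le_toReal h1 (EReal.coe_ne_bot _) htop
  simpa [coneSigma] using this

theorem lintegral_sphere_lt_top (h : IsDualConePair C D) {α : ℝ} (hα : coneSigma C < α) :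
    ∫⁻ t in {t : sphere (0 : Rn n) 1 | (t : Rn n) ∈ C}, coneDelta C (t : Rn n) ^ α
      ∂(volume : Measure (Rn n)).toSphere < ∞ := by
  have hlt : coneSigma0 C < (α : EReal) := by
    by_contra hcon
    have h0 : coneSigma0 C ≤ ((0 : ℝ) : EReal) :=
      sInf_le ⟨0, lintegral_sphere_zero_lt_top C, rfl⟩
    have htop : max (-1 : EReal) (coneSigma0 C) ≠ ⊤ :=
      ne_of_lt (max_lt (by exact EReal.coe_lt_top (-1)) (h0.trans_lt (EReal.coe_lt_top 0)))
    have := EReal.toReal_le_toReal ((not_lt.1 hcon).trans (le_max_right (-1) _))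
      (EReal.coe_ne_bot _) htop
    rw [EReal.toReal_coe] at this
    exact absurd hα (not_lt.2 this)
  obtain ⟨_, ⟨α₀, hα₀, rfl⟩, hlt'⟩ := sInf_lt_iff.1 hlt
  exact h.lintegral_sphere_mono_exponent (EReal.coe_lt_coe_iff.1 hlt').le hα₀

theorem coneLaplace_ne_top_of_coneSigma_lt (h : IsDualConePair C D) {α : ℝ} (hα : coneSigma D < α)
    {t : Rn n} (ht : t ∈ C) : coneLaplace D α t ≠ ⊤ :=
  h.coneLaplace_ne_top ((neg_one_le_coneSigma D).trans_lt hα) (h.symm.lintegral_sphere_lt_top hα) ht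

theorem coneLaplace_zero_ne_top (h : IsDualConePair C D) {t : Rn n} (ht : t ∈ C) :
    coneLaplace D 0 t ≠ ⊤ :=
  h.coneLaplace_ne_top (by norm_num) (lintegral_sphere_zero_lt_top D) ht

theorem coneLaplace_ne_zero (h : IsDualConePair C D) (α : ℝ) (t : Rn n) :
    coneLaplace D α t ≠ 0 := by
  have hmeas : Measurable fun y : Rn n =>
      coneDelta D y ^ α * ENNReal.ofReal (Real.exp (-inner ℝ t y)) :=
    ((measurable_coneDelta h.isOpen_right).pow_const α).mul (by fun_prop)
  rw [coneLaplace, ← pos_iff_ne_zero, setLIntegral_pos_iff hmeas]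
  refine lt_of_lt_of_le (h.isOpen_right.measure_pos volume h.nonempty_right)
    (measure_mono fun y hy => ⟨?_, hy⟩)
  rw [Function.mem_support]
  refine mul_ne_zero ?_ (by simp [Real.exp_pos])
  exact (ENNReal.rpow_pos (pos_iff_ne_zero.2 (h.symm.coneDelta_ne_zero hy))
    (h.symm.coneDelta_ne_top y)).ne'

/-- Substituting `B y` for `y`, with `B` the adjoint of `A`, turns `e^{-x·y}` into `e^{-Ax·y}` and
produces `|det A|^{1+α}`, the factor by which `Δ_C^{1+α}` changes under `A`. -/
theorem coneLaplace_mul_rpow_eq (h : IsDualConePair C D) (α : ℝ) {x x' : Rn n} (hx : x ∈ C)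
    (hx' : x' ∈ C) :
    coneLaplace D α x * coneDelta C x ^ (1 + α) = coneLaplace D α x' * coneDelta C x' ^ (1 + α) := by
  obtain ⟨A, B, hA, hB, hAB, rfl⟩ := h.trans_left x hx x' hx'
  set d := ENNReal.ofReal |LinearMap.det (A : Rn n →ₗ[ℝ] Rn n)| with hd
  have hd0 : d ≠ 0 := ofReal_abs_det_ne_zero A
  have hdt : d ≠ ⊤ := ENNReal.ofReal_ne_top
  have hdB : ENNReal.ofReal |LinearMap.det (B : Rn n →ₗ[ℝ] Rn n)| = d := by
    rw [hd, det_eq_of_inner_eq hAB]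
  have hdα : d ^ α ≠ ⊤ := ENNReal.rpow_ne_top_of_ne_zero hd0 hdt
  have h1 : coneLaplace D α x = d ^ (1 + α) * coneLaplace D α (A x) := by
    calc coneLaplace D α x = ∫⁻ y in B '' D,
          coneDelta D y ^ α * ENNReal.ofReal (Real.exp (-inner ℝ x y)) := by rw [hB, coneLaplace]
      _ = d * ∫⁻ y in D, d ^ α *
          (coneDelta D y ^ α * ENNReal.ofReal (Real.exp (-inner ℝ (A x) y))) := by
        rw [setLIntegral_image_continuousLinearEquiv B h.symm.measurableSet_left, hdB]
        congr 1
        refine lintegral_congr fun y => ?_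
        rw [coneDelta_map hB, hdB, ENNReal.mul_rpow_of_ne_top hdt (h.symm.coneDelta_ne_top y), hAB,
          mul_assoc]
      _ = _ := by
        rw [lintegral_const_mul' _ _ hdα, ← mul_assoc, ENNReal.rpow_add _ _ hd0 hdt,
          ENNReal.rpow_one, coneLaplace]
  rw [h1, coneDelta_map hA, ENNReal.mul_rpow_of_ne_top hdt (h.coneDelta_ne_top x)]
  ring

theorem exists_coneLaplace_eq (h : IsDualConePair C D) {α : ℝ}
    (hα : ∀ t ∈ C, coneLaplace D α t ≠ ⊤) :
    ∃ k : ℝ≥0, k ≠ 0 ∧ ∀ t ∈ C, coneLaplace D α t = k * coneDelta C t ^ (-(1 + α)) := by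
  obtain ⟨e, he⟩ := h.nonempty_left
  have hpow : ∀ t ∈ C, ∀ s : ℝ, coneDelta C t ^ s ≠ ⊤ ∧ coneDelta C t ^ s ≠ 0 := fun t ht s =>
    ⟨ENNReal.rpow_ne_top_of_ne_zero (h.coneDelta_ne_zero ht) (h.coneDelta_ne_top t),
      (ENNReal.rpow_pos (pos_iff_ne_zero.2 (h.coneDelta_ne_zero ht)) (h.coneDelta_ne_top t)).ne'⟩
  have hk : coneLaplace D α e * coneDelta C e ^ (1 + α) ≠ ⊤ :=
    ENNReal.mul_ne_top (hα e he) (hpow e he _).1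
  have hk0 : coneLaplace D α e * coneDelta C e ^ (1 + α) ≠ 0 :=
    mul_ne_zero (h.coneLaplace_ne_zero α e) (hpow e he _).2
  refine ⟨(coneLaplace D α e * coneDelta C e ^ (1 + α)).toNNReal, ?_, fun t ht => ?_⟩
  · exact (ENNReal.toNNReal_pos hk0 hk).ne'
  · rw [ENNReal.coe_toNNReal hk, h.coneLaplace_mul_rpow_eq α he ht, mul_assoc,
      ← ENNReal.rpow_add _ _ (h.coneDelta_ne_zero ht) (h.coneDelta_ne_top t)]
    simp

end IsDualConePair

namespace IsDualConePair

variable {n : ℕ} {C D : Set (Rn n)}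

theorem coneDelta_rpow_add (h : IsDualConePair C D) {x : Rn n} (hx : x ∈ C) (a b : ℝ) :
    coneDelta C x ^ (a + b) = coneDelta C x ^ a * coneDelta C x ^ b :=
  ENNReal.rpow_add _ _ (h.coneDelta_ne_zero hx) (h.coneDelta_ne_top x)

theorem measurableSet_coneInterval (h : IsDualConePair C D) (x : Rn n) :
    MeasurableSet (coneInterval C 0 x) :=
  ((h.isOpen_left.preimage (continuous_id.sub continuous_const)).inter
    (h.isOpen_left.preimage (continuous_const.sub continuous_id))).measurableSet

theorem measurableSet_coneIntervalTop (h : IsDualConePair C D) (x : Rn n) :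
    MeasurableSet (coneIntervalTop C x) :=
  (h.isOpen_left.preimage (continuous_id.sub continuous_const)).measurableSet

theorem coneIntervalTop_subset (h : IsDualConePair C D) {x : Rn n} (hx : x ∈ C) :
    coneIntervalTop C x ⊆ C := fun t ht => by
  simpa using h.add_left _ hx _ ht

/-! ### Integrals of powers of the volume function over cone intervals -/

/-- Both sides scale by `|det A|^{s+1}` under automorphisms, so finiteness at one point `e`
suffices. -/
theorem exists_lintegral_coneInterval_le (h : IsDualConePair C D) {s : ℝ} (hs : coneSigma C < s) :
    ∃ K : ℝ≥0, ∀ t ∈ C, ∫⁻ x in coneInterval C 0 t, coneDelta C x ^ s ≤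
      K * coneDelta C t ^ (s + 1) := by
  obtain ⟨e, he⟩ := h.nonempty_left
  obtain ⟨w, hw⟩ := h.nonempty_right
  have hfin : ∫⁻ x in coneInterval C 0 e, coneDelta C x ^ s ≠ ⊤ := by
    have hL := h.symm.coneLaplace_ne_top_of_coneSigma_lt hs hw
    -- On `⟨0, e⟩` one has `w·x ≤ w·e`, so `1 ≤ e^{-w·x} e^{w·e}` and the Laplace transform at `w`
    -- dominates.
    refine ne_top_of_le_ne_top (ENNReal.mul_ne_top hL
      (ENNReal.ofReal_ne_top (r := Real.exp (inner ℝ w e)))) ?_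
    rw [coneLaplace, ← lintegral_mul_const' _ _ ENNReal.ofReal_ne_top]
    calc _ ≤ ∫⁻ x in coneInterval C 0 e, coneDelta C x ^ s *
            ENNReal.ofReal (Real.exp (-inner ℝ w x)) * ENNReal.ofReal (Real.exp (inner ℝ w e)) := by
          refine setLIntegral_mono' (h.measurableSet_coneInterval e) fun x hx => ?_
          rw [mul_assoc, ← ENNReal.ofReal_mul (Real.exp_pos _).le, ← Real.exp_add]
          refine le_mul_of_one_le_right zero_le ?_
          rw [ENNReal.one_le_ofReal, Real.one_le_exp_iff]
          have := h.symm.inner_nonneg w hw _ hx.2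
          rw [inner_sub_right] at this
          linarith
      _ ≤ _ := by
          refine lintegral_mono_set fun x hx => ?_
          simpa [coneLT] using hx.1
  have he0 := h.coneDelta_ne_zero he
  have het := h.coneDelta_ne_top e
  refine ⟨((∫⁻ x in coneInterval C 0 e, coneDelta C x ^ s) *
    coneDelta C e ^ (-(s + 1))).toNNReal, fun t ht => ?_⟩
  rw [ENNReal.coe_toNNReal
    (ENNReal.mul_ne_top hfin (ENNReal.rpow_ne_top_of_ne_zero he0 het))]
  obtain ⟨A, B, hA, hB, hAB, rfl⟩ := h.trans_left e he t ht
  have hd0 := ofReal_abs_det_ne_zero A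
  rw [coneInterval_map hA, setLIntegral_image_continuousLinearEquiv A (h.measurableSet_coneInterval e)]
  simp_rw [coneDelta_map hA]
  set d := ENNReal.ofReal |LinearMap.det (A : Rn n →ₗ[ℝ] Rn n)|
  have hdt : d ≠ ⊤ := ENNReal.ofReal_ne_top
  simp_rw [ENNReal.mul_rpow_of_ne_top hdt (h.coneDelta_ne_top _)]
  rw [lintegral_const_mul' _ _ (ENNReal.rpow_ne_top_of_ne_zero hd0 hdt)]
  refine le_of_eq ?_
  have h1 : coneDelta C e ^ (-(s + 1)) * coneDelta C e ^ (s + 1) = 1 := by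
    rw [← h.coneDelta_rpow_add he]
    simp
  calc d * (d ^ s * ∫⁻ x in coneInterval C 0 e, coneDelta C x ^ s)
      = (∫⁻ x in coneInterval C 0 e, coneDelta C x ^ s) * d ^ (s + 1) * 1 := by
        rw [ENNReal.rpow_add _ _ hd0 hdt, ENNReal.rpow_one]
        ring
    _ = _ := by
        rw [← h1]
        ring

theorem setLIntegral_coneIntervalTop_eq (h : IsDualConePair C D) (F : Rn n → ℝ≥0∞) (x : Rn n) :
    ∫⁻ t in coneIntervalTop C x, F t = ∫⁻ u in C, F (x + u) := by
  rw [← lintegral_indicator (h.measurableSet_coneIntervalTop x),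
    ← lintegral_indicator h.measurableSet_left, ← lintegral_add_left_eq_self _ x]
  refine lintegral_congr fun u => ?_
  have hmem : x + u ∈ coneIntervalTop C x ↔ u ∈ C := by
    simp only [coneIntervalTop, coneLT, Set.mem_ofPred_eq, add_sub_cancel_left]
  by_cases hu : u ∈ C
  · rw [Set.indicator_of_mem hu, Set.indicator_of_mem (hmem.2 hu)]
  · rw [Set.indicator_of_notMem hu, Set.indicator_of_notMem (mt hmem.1 hu)]

theorem lintegral_coneLaplace_add (h : IsDualConePair C D) (α : ℝ) (x : Rn n) :
    ∫⁻ u in C, coneLaplace D α (x + u) =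
      ∫⁻ y in D, coneDelta D y ^ α * ENNReal.ofReal (Real.exp (-inner ℝ x y)) *
        coneLaplace C 0 y := by
  have hm := (measurable_coneDelta h.isOpen_right).pow_const α
  unfold coneLaplace
  rw [lintegral_lintegral_swap]
  · refine lintegral_congr fun y => ?_
    simp only [ENNReal.rpow_zero, one_mul]
    rw [← lintegral_const_mul _ (by fun_prop)]
    refine lintegral_congr fun u => ?_
    rw [mul_assoc, ← ENNReal.ofReal_mul (Real.exp_pos _).le,
      ← Real.exp_add, inner_add_left, real_inner_comm y u]
    ring_nf
  · refine Measurable.aemeasurable ?_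
    exact (hm.comp measurable_snd).mul (by fun_prop)

/-- `Δ_C^{-β}` is a multiple of the Laplace transform of `Δ_D^{β-1}`. Integrating over the
translated cone, Tonelli gives an extra factor `∫_C e^{-y·u} du`, a multiple of `Δ_D(y)^{-1}`. What
remains is the transform of `Δ_D^{β-2}`, finite exactly under the test `β - 2 > σ(D)`. -/
theorem exists_lintegral_coneIntervalTop_le (h : IsDualConePair C D) {β : ℝ}
    (hβ : 2 + coneSigma D < β) :
    ∃ K : ℝ≥0, ∀ x ∈ C, ∫⁻ t in coneIntervalTop C x, coneDelta C t ^ (-β) ≤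
      K * coneDelta C x ^ (1 - β) := by
  obtain ⟨k₁, hk₁, h₁⟩ := h.exists_coneLaplace_eq (α := β - 1)
    fun t ht => h.coneLaplace_ne_top_of_coneSigma_lt (by linarith) ht
  obtain ⟨k₂, -, h₂⟩ := h.exists_coneLaplace_eq (α := β - 2)
    fun t ht => h.coneLaplace_ne_top_of_coneSigma_lt (by linarith) ht
  obtain ⟨k₀, -, h₀⟩ := h.symm.exists_coneLaplace_eq (α := 0)
    fun t ht => h.symm.coneLaplace_zero_ne_top ht
  refine ⟨k₁⁻¹ * (k₀ * k₂), fun x hx => le_of_eq ?_⟩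
  have hk : (k₁ : ℝ≥0∞) ≠ 0 := by exact_mod_cast hk₁
  have key : k₁ * ∫⁻ t in coneIntervalTop C x, coneDelta C t ^ (-β) =
      k₀ * k₂ * coneDelta C x ^ (1 - β) := by
    calc k₁ * ∫⁻ t in coneIntervalTop C x, coneDelta C t ^ (-β)
        = ∫⁻ u in C, coneLaplace D (β - 1) (x + u) := by
          rw [h.setLIntegral_coneIntervalTop_eq, ← lintegral_const_mul' _ _ ENNReal.coe_ne_top]
          refine setLIntegral_congr_fun h.measurableSet_left fun u hu => ?_
          simp only [h₁ _ (h.add_left x hx u hu)]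
          ring_nf
      _ = ∫⁻ y in D, k₀ *
          (coneDelta D y ^ (β - 2) * ENNReal.ofReal (Real.exp (-inner ℝ x y))) := by
          rw [h.lintegral_coneLaplace_add]
          refine setLIntegral_congr_fun h.symm.measurableSet_left fun y hy => ?_
          simp only [h₀ y hy]
          rw [show β - 2 = β - 1 + (-(1 + 0)) by ring, h.symm.coneDelta_rpow_add hy]
          ring
      _ = k₀ * coneLaplace D (β - 2) x := by
          rw [lintegral_const_mul' _ _ ENNReal.coe_ne_top, coneLaplace]
      _ = _ := by
          rw [h₂ x hx, mul_assoc]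
          ring_nf
  rw [ENNReal.coe_mul, ENNReal.coe_inv hk₁, ENNReal.coe_mul, mul_assoc, ← key, ← mul_assoc,
    ENNReal.inv_mul_cancel hk ENNReal.coe_ne_top, one_mul]

/-! ### Hölder's inequality on the cone -/

theorem aemeasurable_coneDelta_rpow (h : IsDualConePair C D) (a : ℝ) (μ : Measure (Rn n)) :
    AEMeasurable (fun x => coneDelta C x ^ a) μ :=
  ((measurable_coneDelta h.isOpen_left).pow_const a).aemeasurable

/-- For `p > 1`, Hölder puts the weight into `∫_{⟨x,∞⟩} Δ^{-a p'}`, whose exponent exceeds `2 +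
σ(D)` by the condition on `a`. For `p = 1` that condition reads `a > 0`, and `Δ^{-a}` is largest at
`x`. -/
theorem exists_lintegral_mul_rpow_le (h : IsDualConePair C D) {p a : ℝ} (hp : 1 ≤ p)
    (ha : (2 + coneSigma D) * (1 - 1 / p) < a) :
    ∃ K : ℝ≥0, ∀ g : Rn n → ℝ≥0∞, AEMeasurable g (volume.restrict C) → ∀ x ∈ C,
      ∫⁻ t in coneIntervalTop C x, g t * coneDelta C t ^ (-a) ≤
        K * coneDelta C x ^ (1 - 1 / p - a) * (∫⁻ t in coneIntervalTop C x, g t ^ p) ^ (1 / p) := by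
  have hp0 : 0 < p := by linarith
  rcases hp.eq_or_lt with rfl | hp1
  · refine ⟨1, fun g _ x hx => ?_⟩
    have ha0 : 0 < a := by simpa using ha
    simp only [div_one, sub_self, zero_sub, ENNReal.rpow_one, ENNReal.coe_one, one_mul]
    rw [← lintegral_const_mul' _ _
      (ENNReal.rpow_ne_top_of_ne_zero (h.coneDelta_ne_zero hx) (h.coneDelta_ne_top x))]
    refine setLIntegral_mono' (h.measurableSet_coneIntervalTop x) fun t ht => ?_
    rw [mul_comm]
    gcongr ?_ * g t
    rw [ENNReal.rpow_neg, ENNReal.rpow_neg, ENNReal.inv_le_inv]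
    exact ENNReal.rpow_le_rpow (h.coneDelta_mono ht) ha0.le
  · have hθ : 0 < 1 - 1 / p := by
      rw [sub_pos, div_lt_one hp0]
      exact hp1
    set θ := 1 - 1 / p with hθdef
    obtain ⟨K, hK⟩ := h.exists_lintegral_coneIntervalTop_le ((lt_div_iff₀ hθ).2 ha)
    refine ⟨K ^ θ, fun g hg x hx => ?_⟩
    have hsub := h.coneIntervalTop_subset hx
    have hθa : -(a / θ) * θ = -a := by field_simp
    calc ∫⁻ t in coneIntervalTop C x, g t * coneDelta C t ^ (-a)
        = ∫⁻ t in coneIntervalTop C x, (g t ^ p) ^ (1 / p) *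
            (coneDelta C t ^ (-(a / θ))) ^ θ := by
          refine lintegral_congr fun t => ?_
          rw [← ENNReal.rpow_mul, ← ENNReal.rpow_mul, hθa, mul_one_div_cancel hp0.ne',
            ENNReal.rpow_one]
      _ ≤ (∫⁻ t in coneIntervalTop C x, g t ^ p) ^ (1 / p) *
            (∫⁻ t in coneIntervalTop C x, coneDelta C t ^ (-(a / θ))) ^ θ :=
          ENNReal.lintegral_mul_norm_pow_le ((hg.mono_set hsub).pow_const p)
            (h.aemeasurable_coneDelta_rpow _ _) (by positivity) hθ.le (by rw [hθdef]; ring)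
      _ ≤ (∫⁻ t in coneIntervalTop C x, g t ^ p) ^ (1 / p) *
            (K * coneDelta C x ^ (1 - a / θ)) ^ θ := by
          gcongr
          exact hK x hx
      _ = _ := by
          rw [ENNReal.mul_rpow_of_nonneg _ _ hθ.le, ← ENNReal.rpow_mul,
            show (1 - a / θ) * θ = θ - a by field_simp, ENNReal.coe_rpow_of_nonneg _ hθ.le]
          ring

/-- Hölder applied to `u Δ^{sp/q} = u^{1-p/q} (u Δ^s)^{p/q}`. This trades the outer power `q/p` for
a power of the total mass, leaving an integral linear in `u Δ^s`. -/
theorem lintegral_mul_coneDelta_rpow_le (h : IsDualConePair C D) {u : Rn n → ℝ≥0∞}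
    (hu : AEMeasurable u (volume.restrict C)) {p q s : ℝ} (hp : 0 < p) (hpq : p ≤ q)
    {x : Rn n} (hx : x ∈ C) :
    (∫⁻ t in coneIntervalTop C x, u t * coneDelta C t ^ (s * (p / q))) ^ (q / p) ≤
      (∫⁻ t in C, u t) ^ (q / p - 1) * ∫⁻ t in coneIntervalTop C x, u t * coneDelta C t ^ s := by
  have hq : 0 < q := by linarith
  have hτ : 0 ≤ 1 - p / q := by
    rw [sub_nonneg, div_le_one hq]
    exact hpq
  have hsub := h.coneIntervalTop_subset hx
  have hpq0 : 0 < p / q := by positivity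
  have hqp0 : 0 < q / p := by positivity
  have hmul : p / q * (q / p) = 1 := by field_simp
  calc (∫⁻ t in coneIntervalTop C x, u t * coneDelta C t ^ (s * (p / q))) ^ (q / p)
      = (∫⁻ t in coneIntervalTop C x, u t ^ (1 - p / q) *
          (u t * coneDelta C t ^ s) ^ (p / q)) ^ (q / p) := by
        congr 1
        refine lintegral_congr fun t => ?_
        rw [ENNReal.mul_rpow_of_nonneg _ _ hpq0.le, ← mul_assoc,
          ← ENNReal.rpow_add_of_nonneg _ _ hτ hpq0.le, ← ENNReal.rpow_mul]
        simp
    _ ≤ ((∫⁻ t in coneIntervalTop C x, u t) ^ (1 - p / q) *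
          (∫⁻ t in coneIntervalTop C x, u t * coneDelta C t ^ s) ^ (p / q)) ^ (q / p) := by
        gcongr
        exact ENNReal.lintegral_mul_norm_pow_le (hu.mono_set hsub)
          ((hu.mono_set hsub).mul (h.aemeasurable_coneDelta_rpow _ _)) hτ hpq0.le (by ring)
    _ = (∫⁻ t in coneIntervalTop C x, u t) ^ (q / p - 1) *
          ∫⁻ t in coneIntervalTop C x, u t * coneDelta C t ^ s := by
        rw [ENNReal.mul_rpow_of_nonneg _ _ hqp0.le, ← ENNReal.rpow_mul, ← ENNReal.rpow_mul, hmul,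
          ENNReal.rpow_one, sub_mul, hmul, one_mul]
    _ ≤ _ := by
        gcongr
        rw [sub_nonneg, one_le_div hp]
        exact hpq

/-- After Tonelli the inner integral is that of `Δ^s` over `⟨0, t⟩`, whose bound `K Δ(t)^{s+1}`
cancels the weight. -/
theorem exists_lintegral_lintegral_le (h : IsDualConePair C D) {s : ℝ} (hs : coneSigma C < s) :
    ∃ K : ℝ≥0, ∀ u : Rn n → ℝ≥0∞, AEMeasurable u (volume.restrict C) →
      ∫⁻ x in C, coneDelta C x ^ s * ∫⁻ t in coneIntervalTop C x,
        u t * coneDelta C t ^ (-(s + 1)) ≤ K * ∫⁻ t in C, u t := by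
  obtain ⟨K, hK⟩ := h.exists_lintegral_coneInterval_le hs
  refine ⟨K, fun u hu => ?_⟩
  set G : Rn n → ℝ≥0∞ := fun t => u t * coneDelta C t ^ (-(s + 1)) with hG
  have hGm : AEMeasurable G (volume.restrict C) := hu.mul (h.aemeasurable_coneDelta_rpow _ _)
  have hset : MeasurableSet {z : Rn n × Rn n | z.2 - z.1 ∈ C} :=
    (h.isOpen_left.preimage (continuous_snd.sub continuous_fst)).measurableSet
  calc ∫⁻ x in C, coneDelta C x ^ s * ∫⁻ t in coneIntervalTop C x, G t
      = ∫⁻ x in C, ∫⁻ t in C, {z : Rn n × Rn n | z.2 - z.1 ∈ C}.indicator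
          (fun z => coneDelta C z.1 ^ s * G z.2) (x, t) := by
        refine setLIntegral_congr_fun h.measurableSet_left fun x hx => ?_
        have hpow : coneDelta C x ^ s ≠ ⊤ :=
          ENNReal.rpow_ne_top_of_ne_zero (h.coneDelta_ne_zero hx) (h.coneDelta_ne_top x)
        have hind : ∀ t, {z : Rn n × Rn n | z.2 - z.1 ∈ C}.indicator
            (fun z => coneDelta C z.1 ^ s * G z.2) (x, t) =
            (coneIntervalTop C x).indicator (fun t => coneDelta C x ^ s * G t) t := fun t => rfl
        simp only [hind]
        rw [lintegral_indicator (h.measurableSet_coneIntervalTop x),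
          Measure.restrict_restrict (h.measurableSet_coneIntervalTop x),
          Set.inter_eq_self_of_subset_left (h.coneIntervalTop_subset hx),
          lintegral_const_mul' _ _ hpow]
    _ = ∫⁻ t in C, ∫⁻ x in C, {z : Rn n × Rn n | z.2 - z.1 ∈ C}.indicator
          (fun z => coneDelta C z.1 ^ s * G z.2) (x, t) := by
        refine lintegral_lintegral_swap ?_
        exact ((h.aemeasurable_coneDelta_rpow s _).comp_fst.mul hGm.comp_snd).indicator hset
    _ ≤ ∫⁻ t in C, K * u t := by
        refine setLIntegral_mono' h.measurableSet_left fun t ht => ?_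
        have hind : ∀ x, {z : Rn n × Rn n | z.2 - z.1 ∈ C}.indicator
            (fun z => coneDelta C z.1 ^ s * G z.2) (x, t) =
            {x | t - x ∈ C}.indicator (fun x => coneDelta C x ^ s * G t) x := fun x => rfl
        have hset' : MeasurableSet {x | t - x ∈ C} :=
          (h.isOpen_left.preimage (continuous_const.sub continuous_id)).measurableSet
        have hint : {x | t - x ∈ C} ∩ C = coneInterval C 0 t := by
          ext x
          simp [coneInterval, coneLT, and_comm]
        simp only [hind]
        rw [lintegral_indicator hset', Measure.restrict_restrict hset', hint,
          lintegral_mul_const _ ((measurable_coneDelta h.isOpen_left).pow_const s)]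
        calc (∫⁻ x in coneInterval C 0 t, coneDelta C x ^ s) * G t
            ≤ K * coneDelta C t ^ (s + 1) * G t := by
              gcongr
              exact hK t ht
          _ = K * u t * (coneDelta C t ^ (s + 1) * coneDelta C t ^ (-(s + 1))) := by
              rw [hG]
              ring
          _ = K * u t := by
              rw [← h.coneDelta_rpow_add ht]
              simp
    _ = K * ∫⁻ t in C, u t := lintegral_const_mul' _ _ ENNReal.coe_ne_top

end IsDualConePair

/-! ### Domains of positivity with positive definite characteristic -/

theorem exists_equiv_inner_eq_dotProduct {n : ℕ} {S : Matrix (Fin n) (Fin n) ℝ} (hS : S.PosDef) :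
    ∃ T : Rn n ≃L[ℝ] Rn n,
      ∀ x y : Rn n, inner ℝ x (T y) = WithLp.ofLp x ⬝ᵥ S *ᵥ WithLp.ofLp y := by
  have hT : ∀ x y : Rn n, inner ℝ x (Matrix.toEuclideanLin S y) =
      WithLp.ofLp x ⬝ᵥ S *ᵥ WithLp.ofLp y := fun x y => by
    rw [EuclideanSpace.inner_eq_star_dotProduct, dotProduct_comm]
    simp
  have hinj : Function.Injective (Matrix.toEuclideanLin S) := by
    rw [injective_iff_map_eq_zero]
    intro y hy
    by_contra hy0
    have h1 := hT y y
    rw [hy, inner_zero_right] at h1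
    have h2 := hS.dotProduct_mulVec_pos (x := WithLp.ofLp y) (by simpa using hy0)
    simp only [star_trivial] at h2
    exact h2.ne h1
  exact ⟨(LinearEquiv.ofInjectiveEndo _ hinj).toContinuousLinearEquiv, hT⟩

/-- If `x` satisfies the right-hand condition, `insert x V` still has the positivity property, so
maximality puts `x` in `V`. The new pair `(x, x)` is covered by positive definiteness, the mixed
pairs by symmetry. -/
theorem IsCharacteristic.mem_iff {n : ℕ} {S : Matrix (Fin n) (Fin n) ℝ} {V : Set (Rn n)}
    (hS : S.PosDef) (hV : IsCharacteristic S V) {T : Rn n ≃L[ℝ] Rn n}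
    (hT : ∀ x y : Rn n, inner ℝ x (T y) = WithLp.ofLp x ⬝ᵥ S *ᵥ WithLp.ofLp y)
    (hTsymm : ∀ x y, inner ℝ x (T y) = inner ℝ y (T x)) (x : Rn n) :
    x ∈ V ↔ ∀ y ∈ closure V, y ≠ 0 → 0 < inner ℝ y (T x) := by
  have hpos : ∀ y ∈ closure V, y ≠ 0 → ∀ x ∈ V, 0 < inner ℝ y (T x) := fun y hy hy0 x hx => by
    rw [hT]
    exact hV.maximal.prop y hy hy0 x hx
  refine ⟨fun hx y hy hy0 => hpos y hy hy0 x hx, fun hx => ?_⟩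
  have hle : insert x V ≤ V := by
    refine hV.maximal.le_of_ge ?_ (Set.subset_insert x V)
    intro y hy hy0 x' hx'
    rw [← hT]
    rw [Set.insert_eq, closure_union, closure_singleton] at hy
    rcases hy with rfl | hy
    · rcases hx' with rfl | hx'
      · rw [hT]
        have h2 := hS.dotProduct_mulVec_pos (x := WithLp.ofLp x') (by simpa using hy0)
        simpa using h2
      · rcases eq_or_ne x' 0 with rfl | hx0
        -- The point `0` cannot lie in `V`: openness would supply a nonzero point of `V`, whose
        -- pairing with `0` would have to be positive.
        · obtain ⟨ε, hε, hball⟩ := Metric.isOpen_iff.1 hV.isOpen 0 hx'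
          have hy1 : 0 < ‖y‖ := norm_pos_iff.2 hy0
          have hmem : (ε / 2 / ‖y‖) • y ∈ V := by
            apply hball
            rw [mem_ball_zero_iff, norm_smul, Real.norm_of_nonneg (by positivity),
              div_mul_cancel₀ _ hy1.ne']
            linarith
          have := hpos _ (subset_closure hmem) (smul_ne_zero (by positivity) hy0) 0 hx'
          simp at this
        · rw [hTsymm]
          exact hx x' (subset_closure hx') hx0
    · rcases hx' with rfl | hx'
      · exact hx y hy hy0
      · exact hpos y hy hy0 x' hx'
  exact hle (Set.mem_insert x V)

/-- The map `T` given by `S` carries `V` onto `V*`, so convexity, scaling and transitivity transfer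
by conjugation with `T`. -/
theorem IsCharacteristic.isDualConePair {n : ℕ} {S : Matrix (Fin n) (Fin n) ℝ} {V : Set (Rn n)}
    (hS : S.PosDef) (hV : IsCharacteristic S V) (hhom : IsHomogeneousSet V) :
    IsDualConePair V (dualCone V) := by
  obtain ⟨T, hT⟩ := exists_equiv_inner_eq_dotProduct hS
  have hTsymm : ∀ x y, inner ℝ x (T y) = inner ℝ y (T x) := fun x y => by
    rw [hT, hT, Matrix.dotProduct_mulVec, ← Matrix.mulVec_transpose, hV.isSymm.eq, dotProduct_comm]
  have hmem := hV.mem_iff hS hT hTsymm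
  have hTV : ∀ x, T x ∈ dualCone V ↔ x ∈ V := fun x => by
    rw [hmem]
    simp only [dualCone, Set.mem_ofPred_eq, real_inner_comm (T x)]
  have hdual : dualCone V = T '' V := by
    ext y
    obtain ⟨x, rfl⟩ := T.surjective y
    rw [hTV, T.injective.mem_set_image]
  have hadj : ∀ A B : Rn n ≃L[ℝ] Rn n, A '' V = V → (∀ x y, inner ℝ (A x) y = inner ℝ x (B y)) →
      B '' dualCone V = dualCone V := by
    intro A B hA hAB
    have hAcl : ∀ y, A y ∈ closure V ↔ y ∈ closure V := fun y => by
      have : closure V = A '' closure V := by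
        conv_lhs => rw [← hA]
        exact (A.toHomeomorph.image_closure V).symm
      conv_lhs => rw [this]
      exact A.injective.mem_set_image
    have hB : ∀ w, B w ∈ dualCone V ↔ w ∈ dualCone V := by
      intro w
      simp only [dualCone, Set.mem_ofPred_eq]
      constructor
      · intro hw y hy hy0
        obtain ⟨z, rfl⟩ := A.surjective y
        have := hw z ((hAcl z).1 hy) (by rintro rfl; simp at hy0)
        rwa [real_inner_comm, ← hAB, real_inner_comm] at this
      · intro hw y hy hy0
        rw [real_inner_comm, ← hAB, real_inner_comm]
        exact hw _ ((hAcl y).2 hy) (by simpa using hy0)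
    ext w
    obtain ⟨z, rfl⟩ := B.surjective w
    rw [B.injective.mem_set_image, hB]
  have hne : V.Nonempty := by
    by_contra hcon
    rw [Set.not_nonempty_iff_eq_empty] at hcon
    have : (0 : Rn n) ∈ V := (hmem 0).2 (by simp [hcon])
    simp [hcon] at this
  have hadd : ∀ x ∈ V, ∀ y ∈ V, x + y ∈ V := fun x hx y hy => by
    rw [hmem] at hx hy ⊢
    intro z hz hz0
    rw [map_add, inner_add_right]
    exact add_pos (hx z hz hz0) (hy z hz hz0)
  have hsmul : ∀ c : ℝ, 0 < c → ∀ x ∈ V, c • x ∈ V := fun c hc x hx => by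
    rw [hmem] at hx ⊢
    intro z hz hz0
    rw [map_smul, real_inner_smul_right]
    exact mul_pos hc (hx z hz hz0)
  refine
    { isOpen_left := hV.isOpen
      isOpen_right := by
        rw [hdual]
        exact T.toHomeomorph.isOpenMap _ hV.isOpen
      nonempty_left := hne
      nonempty_right := by
        rw [hdual]
        exact hne.image T
      add_left := hadd
      add_right := ?_
      smul_left := hsmul
      smul_right := ?_
      inner_nonneg := ?_
      trans_left := ?_
      trans_right := ?_ }
  · rw [hdual]
    rintro _ ⟨x, hx, rfl⟩ _ ⟨y, hy, rfl⟩
    exact ⟨x + y, hadd x hx y hy, map_add T x y⟩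
  · rw [hdual]
    rintro c hc _ ⟨x, hx, rfl⟩
    exact ⟨c • x, hsmul c hc x hx, map_smul T c x⟩
  · intro x hx y hy
    rcases eq_or_ne x 0 with rfl | hx0
    · simp
    · rw [real_inner_comm]
      exact (hy x (subset_closure hx) hx0).le
  · intro x hx x' hx'
    obtain ⟨A, hA, hAx⟩ := hhom x hx x' hx'
    obtain ⟨B, hB⟩ := exists_inner_adjoint_equiv A
    exact ⟨A, B, hA, hadj A B hA hB, hB, hAx⟩
  · rw [hdual]
    rintro _ ⟨x, hx, rfl⟩ _ ⟨x', hx', rfl⟩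
    obtain ⟨A, hA, hAx⟩ := hhom x hx x' hx'
    obtain ⟨B, hB⟩ := exists_inner_adjoint_equiv A
    have hBV := hadj A B hA hB
    rw [hdual] at hBV
    -- As `T` is self-adjoint, the adjoint of `T A T⁻¹` is `T⁻¹ B T`, which preserves `V` because
    -- `B` preserves `V* = T V`.
    refine ⟨(T.symm.trans A).trans T, (T.trans B).trans T.symm, ?_, ?_, fun u v => ?_, ?_⟩
    · calc ((T.symm.trans A).trans T) '' (T '' V) = T '' (A '' V) := by
            simp [Set.image_image]
        _ = T '' V := by rw [hA]
    · calc ((T.trans B).trans T.symm) '' V = T.symm '' (B '' (T '' V)) := by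
            rw [Set.image_image, Set.image_image]
            rfl
        _ = V := by
            rw [hBV, Set.image_image]
            simp
    · obtain ⟨z, rfl⟩ := T.surjective u
      simp only [ContinuousLinearEquiv.trans_apply, ContinuousLinearEquiv.symm_apply_apply]
      rw [real_inner_comm, hTsymm, hB, real_inner_comm _ (T z), hTsymm,
        ContinuousLinearEquiv.apply_symm_apply]
    · simp [hAx]

/-! ### Weyl fractional integrals -/

namespace IsDualConePair

variable {n : ℕ} {C D : Set (Rn n)}

/-- Since `t - (t - x) = x` lies in the cone, `Δ(t - x) ≤ Δ(t)`, and the exponent `r - 1` is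
nonnegative. -/
theorem weylOp_le (h : IsDualConePair C D) {r : ℝ} (hr : 1 ≤ r) (f : Rn n → ℝ≥0∞) {x : Rn n}
    (hx : x ∈ C) :
    weylOp C r f x ≤ ENNReal.ofReal (1 / Real.Gamma r) *
      ∫⁻ t in coneIntervalTop C x, coneDelta C t ^ (r - 1) * f t := by
  rw [weylOp]
  gcongr ENNReal.ofReal (1 / Real.Gamma r) * ?_
  refine setLIntegral_mono' (h.measurableSet_coneIntervalTop x) fun t ht => ?_
  gcongr ?_ * f t
  refine ENNReal.rpow_le_rpow (h.coneDelta_mono ?_) (by linarith)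
  rwa [sub_sub_cancel]

theorem coneDelta_rpow_mul_rpow_eq_one (h : IsDualConePair C D) {x : Rn n} (hx : x ∈ C) {a b : ℝ}
    (hab : a + b = 0) : coneDelta C x ^ a * coneDelta C x ^ b = 1 := by
  rw [← h.coneDelta_rpow_add hx, hab, ENNReal.rpow_zero]

theorem exists_weylOp_essSup_le_essSup (h : IsDualConePair C D) {r α : ℝ} (hr : 1 ≤ r)
    (hα : 2 + coneSigma D < α) :
    ∃ c : ℝ≥0, ∀ f : Rn n → ℝ≥0∞,
      essSup (fun x => coneDelta C x ^ (-1 + α) *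
          weylOp C r (fun t => f t * coneDelta C t ^ (-α)) x) (volume.restrict C) ≤
        c * essSup (fun x => f x * coneDelta C x ^ (r - 1)) (volume.restrict C) := by
  obtain ⟨K, hK⟩ := h.exists_lintegral_coneIntervalTop_le hα
  refine ⟨(1 / Real.Gamma r).toNNReal * K, fun f => ?_⟩
  set M := essSup (fun x => f x * coneDelta C x ^ (r - 1)) (volume.restrict C) with hM
  refine essSup_le_of_ae_le _ ?_
  filter_upwards [ae_restrict_mem h.measurableSet_left] with x hx
  have hsub := h.coneIntervalTop_subset hx
  have hae : ∀ᵐ t ∂(volume.restrict (coneIntervalTop C x)),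
      f t * coneDelta C t ^ (r - 1) ≤ M :=
    ae_restrict_of_ae_restrict_of_subset hsub (ENNReal.ae_le_essSup _)
  have hint : ∫⁻ t in coneIntervalTop C x,
      coneDelta C t ^ (r - 1) * (f t * coneDelta C t ^ (-α)) ≤
        K * coneDelta C x ^ (1 - α) * M := by
    calc _ ≤ ∫⁻ t in coneIntervalTop C x, coneDelta C t ^ (-α) * M := by
          refine lintegral_mono_ae ?_
          filter_upwards [hae] with t ht
          calc _ = coneDelta C t ^ (-α) * (f t * coneDelta C t ^ (r - 1)) := by ring
            _ ≤ _ := by gcongr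
      _ = (∫⁻ t in coneIntervalTop C x, coneDelta C t ^ (-α)) * M :=
          lintegral_mul_const _ ((measurable_coneDelta h.isOpen_left).pow_const _)
      _ ≤ _ := by
          gcongr
          exact hK x hx
  calc _ ≤ coneDelta C x ^ (-1 + α) * (ENNReal.ofReal (1 / Real.Gamma r) *
        (K * coneDelta C x ^ (1 - α) * M)) := by
        gcongr
        exact (h.weylOp_le hr _ hx).trans (by gcongr)
    _ = ENNReal.ofReal (1 / Real.Gamma r) * K *
        (coneDelta C x ^ (-1 + α) * coneDelta C x ^ (1 - α)) * M := by ring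
    _ = _ := by
        rw [h.coneDelta_rpow_mul_rpow_eq_one hx (by ring), mul_one, ENNReal.coe_mul]
        rfl

theorem exists_weylOp_essSup_le_lintegral (h : IsDualConePair C D) {r p α : ℝ} (hr : 1 ≤ r)
    (hp : 1 ≤ p) (hα : coneSigma D * (1 - 1 / p) + 2 - 1 / p < α) :
    ∃ c : ℝ≥0, ∀ f : Rn n → ℝ≥0∞, AEMeasurable f (volume.restrict C) →
      essSup (fun x => coneDelta C x ^ (-1 + α) *
          weylOp C r (fun t => f t * coneDelta C t ^ (-α)) x) (volume.restrict C) ≤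
        c * (∫⁻ x in C, f x ^ p * coneDelta C x ^ ((r - 1) * p - 1)) ^ (1 / p) := by
  have hp0 : 0 < p := by linarith
  -- With this `a` the resulting power `1/p' - a` is `1 - α`, and the condition on `a` is the
  -- hypothesis on `α`.
  obtain ⟨K, hK⟩ := h.exists_lintegral_mul_rpow_le (a := α - 1 / p) hp (by linarith)
  refine ⟨(1 / Real.Gamma r).toNNReal * K, fun f hf => ?_⟩
  refine essSup_le_of_ae_le _ ?_
  filter_upwards [ae_restrict_mem h.measurableSet_left] with x hx
  have hsub := h.coneIntervalTop_subset hx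
  have hg : AEMeasurable (fun t => f t * coneDelta C t ^ (r - 1 - 1 / p)) (volume.restrict C) :=
    hf.mul (h.aemeasurable_coneDelta_rpow _ _)
  have hint : ∫⁻ t in coneIntervalTop C x,
      coneDelta C t ^ (r - 1) * (f t * coneDelta C t ^ (-α)) ≤
        K * coneDelta C x ^ (1 - α) *
          (∫⁻ x in C, f x ^ p * coneDelta C x ^ ((r - 1) * p - 1)) ^ (1 / p) := by
    calc _ = ∫⁻ t in coneIntervalTop C x, f t * coneDelta C t ^ (r - 1 - 1 / p) *
            coneDelta C t ^ (-(α - 1 / p)) := by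
          refine setLIntegral_congr_fun (h.measurableSet_coneIntervalTop x) fun t ht => ?_
          rw [mul_assoc, ← h.coneDelta_rpow_add (hsub ht), mul_left_comm,
            ← h.coneDelta_rpow_add (hsub ht)]
          ring_nf
      _ ≤ K * coneDelta C x ^ (1 - 1 / p - (α - 1 / p)) * (∫⁻ t in coneIntervalTop C x,
            (f t * coneDelta C t ^ (r - 1 - 1 / p)) ^ p) ^ (1 / p) := hK _ hg x hx
      _ ≤ K * coneDelta C x ^ (1 - 1 / p - (α - 1 / p)) * (∫⁻ t in C,
            (f t * coneDelta C t ^ (r - 1 - 1 / p)) ^ p) ^ (1 / p) := by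
          gcongr
      _ = _ := by
          have hexp : (r - 1 - 1 / p) * p = (r - 1) * p - 1 := by field_simp
          simp_rw [ENNReal.mul_rpow_of_nonneg _ _ hp0.le, ← ENNReal.rpow_mul, hexp]
          ring_nf
  calc _ ≤ coneDelta C x ^ (-1 + α) * (ENNReal.ofReal (1 / Real.Gamma r) *
        (K * coneDelta C x ^ (1 - α) *
          (∫⁻ x in C, f x ^ p * coneDelta C x ^ ((r - 1) * p - 1)) ^ (1 / p))) := by
        gcongr
        exact (h.weylOp_le hr _ hx).trans (by gcongr)
    _ = ENNReal.ofReal (1 / Real.Gamma r) * K *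
        (coneDelta C x ^ (-1 + α) * coneDelta C x ^ (1 - α)) *
          (∫⁻ x in C, f x ^ p * coneDelta C x ^ ((r - 1) * p - 1)) ^ (1 / p) := by ring
    _ = _ := by
        rw [h.coneDelta_rpow_mul_rpow_eq_one hx (by ring), mul_one, ENNReal.coe_mul]
        rfl

theorem exists_weylOp_lintegral_le (h : IsDualConePair C D) {r p q γ : ℝ} (hr : 1 ≤ r)
    (hp : 1 ≤ p) (hpq : p ≤ q)
    (hγ : coneSigma C + coneSigma D * (q * (1 - 1 / p)) + 2 * q - q / p < γ) :
    ∃ c : ℝ≥0, ∀ f : Rn n → ℝ≥0∞, AEMeasurable f (volume.restrict C) →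
      (∫⁻ x in C, coneDelta C x ^ (γ - q) * weylOp C r f x ^ q) ^ (1 / q) ≤
        c * (∫⁻ x in C, f x ^ p * coneDelta C x ^ ((r - 1) * p + (γ + 1) * p / q - 1))
          ^ (1 / p) := by
  have hp0 : 0 < p := by linarith
  have hq0 : 0 < q := by linarith
  -- The lower bound on `a` serves Hölder on `⟨x, ∞⟩`; the upper bound is `s > σ(C)` for the
  -- exponent `s` below. The gap between them is the hypothesis on `γ`.
  obtain ⟨a, ha₁, ha₂⟩ : ∃ a, (2 + coneSigma D) * (1 - 1 / p) < a ∧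
      a < (γ - q / p - coneSigma C) / q := by
    refine exists_between ((lt_div_iff₀ hq0).2 ?_)
    have : (2 + coneSigma D) * (1 - 1 / p) * q =
      coneSigma D * (q * (1 - 1 / p)) + 2 * q - q / p - q / p := by ring
    linarith
  rw [lt_div_iff₀ hq0] at ha₂
  obtain ⟨K₁, hK₁⟩ := h.exists_lintegral_mul_rpow_le hp ha₁
  obtain ⟨K₂, hK₂⟩ := h.exists_lintegral_lintegral_le (s := γ - q / p - a * q) (by linarith)
  -- This is the power of `Δ(x)` left after raising to `q`: `γ - q + (1/p' - a) q`.
  set s := γ - q / p - a * q with hs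
  set c₁ : ℝ≥0∞ := ENNReal.ofReal (1 / Real.Gamma r) * K₁ with hc₁
  have hc₁t : c₁ ^ q ≠ ⊤ := ENNReal.rpow_ne_top_of_nonneg hq0.le
    (ENNReal.mul_ne_top ENNReal.ofReal_ne_top ENNReal.coe_ne_top)
  -- The `+ 1` keeps the constant nonzero, so that the right side is `⊤` when `∫ u` is, despite `0 *
  -- ⊤ = 0`.
  refine ⟨(1 / Real.Gamma r).toNNReal * K₁ * K₂ ^ (1 / q) + 1, fun f hf => ?_⟩
  set u : Rn n → ℝ≥0∞ := fun x =>
    f x ^ p * coneDelta C x ^ ((r - 1) * p + (γ + 1) * p / q - 1) with hu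
  rcases eq_or_ne (∫⁻ t in C, u t) ⊤ with htop | hfin
  · rw [htop, ENNReal.top_rpow_of_pos (by positivity), ENNReal.mul_top (by simp)]
    exact le_top
  have hum : AEMeasurable u (volume.restrict C) :=
    (hf.pow_const p).mul (h.aemeasurable_coneDelta_rpow _ _)
  have hgm : AEMeasurable (fun t => f t * coneDelta C t ^ (r - 1 + a)) (volume.restrict C) :=
    hf.mul (h.aemeasurable_coneDelta_rpow _ _)
  have hqp0 : 0 ≤ q / p - 1 := by
    rw [sub_nonneg, one_le_div hp0]
    exact hpq
  have hW : ∀ x ∈ C, weylOp C r f x ≤ c₁ * coneDelta C x ^ (1 - 1 / p - a) *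
      (∫⁻ t in coneIntervalTop C x, u t * coneDelta C t ^ (-(s + 1) * (p / q))) ^ (1 / p) := by
    intro x hx
    have hsub := h.coneIntervalTop_subset hx
    calc weylOp C r f x ≤ ENNReal.ofReal (1 / Real.Gamma r) *
          ∫⁻ t in coneIntervalTop C x, coneDelta C t ^ (r - 1) * f t := h.weylOp_le hr f hx
      _ = ENNReal.ofReal (1 / Real.Gamma r) * ∫⁻ t in coneIntervalTop C x,
            f t * coneDelta C t ^ (r - 1 + a) * coneDelta C t ^ (-a) := by
          congr 1
          refine setLIntegral_congr_fun (h.measurableSet_coneIntervalTop x) fun t ht => ?_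
          rw [mul_assoc, ← h.coneDelta_rpow_add (hsub ht), mul_comm]
          ring_nf
      _ ≤ ENNReal.ofReal (1 / Real.Gamma r) * (K₁ * coneDelta C x ^ (1 - 1 / p - a) *
            (∫⁻ t in coneIntervalTop C x, (f t * coneDelta C t ^ (r - 1 + a)) ^ p) ^ (1 / p)) := by
          gcongr
          exact hK₁ _ hgm x hx
      _ = c₁ * coneDelta C x ^ (1 - 1 / p - a) *
            (∫⁻ t in coneIntervalTop C x, (f t * coneDelta C t ^ (r - 1 + a)) ^ p) ^ (1 / p) := by
          rw [hc₁]
          ring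
      _ = _ := by
          congr 2
          refine setLIntegral_congr_fun (h.measurableSet_coneIntervalTop x) fun t ht => ?_
          simp only [hu]
          rw [mul_assoc, ← h.coneDelta_rpow_add (hsub ht), ENNReal.mul_rpow_of_nonneg _ _ hp0.le,
            ← ENNReal.rpow_mul]
          congr 2
          rw [hs]
          field_simp
          ring
  have hpt : ∀ x ∈ C, coneDelta C x ^ (γ - q) * weylOp C r f x ^ q ≤
      c₁ ^ q * (∫⁻ t in C, u t) ^ (q / p - 1) *
        (coneDelta C x ^ s * ∫⁻ t in coneIntervalTop C x, u t * coneDelta C t ^ (-(s + 1))) := by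
    intro x hx
    calc coneDelta C x ^ (γ - q) * weylOp C r f x ^ q
        ≤ coneDelta C x ^ (γ - q) * (c₁ * coneDelta C x ^ (1 - 1 / p - a) *
            (∫⁻ t in coneIntervalTop C x, u t * coneDelta C t ^ (-(s + 1) * (p / q)))
              ^ (1 / p)) ^ q := by
          gcongr
          exact hW x hx
      _ = c₁ ^ q * coneDelta C x ^ s *
            (∫⁻ t in coneIntervalTop C x, u t * coneDelta C t ^ (-(s + 1) * (p / q)))
              ^ (q / p) := by
          -- The powers of `Δ(x)` are combined only through this identity, which the point `x ∈ C`
          -- permits since `Δ(x)` is neither `0` nor `⊤`.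
          have hexp : s = (γ - q) + (1 - 1 / p - a) * q := by
            rw [hs]
            field_simp
            ring
          rw [ENNReal.mul_rpow_of_nonneg _ _ hq0.le, ENNReal.mul_rpow_of_nonneg _ _ hq0.le,
            ← ENNReal.rpow_mul, ← ENNReal.rpow_mul, one_div_mul_eq_div]
          conv_rhs => rw [hexp, h.coneDelta_rpow_add hx]
          rw [← hexp]
          ring
      _ ≤ c₁ ^ q * coneDelta C x ^ s * ((∫⁻ t in C, u t) ^ (q / p - 1) *
            ∫⁻ t in coneIntervalTop C x, u t * coneDelta C t ^ (-(s + 1))) := by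
          gcongr
          exact h.lintegral_mul_coneDelta_rpow_le hum hp0 hpq hx
      _ = _ := by ring
  have htot : ∫⁻ x in C, coneDelta C x ^ (γ - q) * weylOp C r f x ^ q ≤
      c₁ ^ q * K₂ * (∫⁻ t in C, u t) ^ (q / p) := by
    have hconst : c₁ ^ q * (∫⁻ t in C, u t) ^ (q / p - 1) ≠ ⊤ :=
      ENNReal.mul_ne_top hc₁t (ENNReal.rpow_ne_top_of_nonneg hqp0 hfin)
    calc ∫⁻ x in C, coneDelta C x ^ (γ - q) * weylOp C r f x ^ q
        ≤ c₁ ^ q * (∫⁻ t in C, u t) ^ (q / p - 1) * ∫⁻ x in C, coneDelta C x ^ s *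
            ∫⁻ t in coneIntervalTop C x, u t * coneDelta C t ^ (-(s + 1)) := by
          rw [← lintegral_const_mul' _ _ hconst]
          exact setLIntegral_mono' h.measurableSet_left hpt
      _ ≤ c₁ ^ q * (∫⁻ t in C, u t) ^ (q / p - 1) * (K₂ * ∫⁻ t in C, u t) := by
          gcongr
          exact hK₂ u hum
      _ = c₁ ^ q * K₂ * ((∫⁻ t in C, u t) ^ (q / p - 1) * (∫⁻ t in C, u t) ^ (1 : ℝ)) := by
          rw [ENNReal.rpow_one]
          ring
      _ = _ := by
          rw [← ENNReal.rpow_add_of_nonneg _ _ hqp0 zero_le_one, sub_add_cancel]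
  calc (∫⁻ x in C, coneDelta C x ^ (γ - q) * weylOp C r f x ^ q) ^ (1 / q)
      ≤ (c₁ ^ q * K₂ * (∫⁻ t in C, u t) ^ (q / p)) ^ (1 / q) := by gcongr
    _ = c₁ * K₂ ^ (1 / q) * (∫⁻ t in C, u t) ^ (1 / p) := by
        have hq1 : 0 ≤ 1 / q := by positivity
        rw [ENNReal.mul_rpow_of_nonneg _ _ hq1, ENNReal.mul_rpow_of_nonneg _ _ hq1,
          ← ENNReal.rpow_mul, ← ENNReal.rpow_mul, mul_one_div_cancel hq0.ne', ENNReal.rpow_one]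
        congr 2
        field_simp
    _ = ((1 / Real.Gamma r).toNNReal * K₁ * K₂ ^ (1 / q) : ℝ≥0) *
          (∫⁻ t in C, u t) ^ (1 / p) := by
        rw [ENNReal.coe_mul, ENNReal.coe_mul, ENNReal.coe_rpow_of_nonneg _ (by positivity)]
        rfl
    _ ≤ _ := by
        gcongr
        exact le_self_add

end IsDualConePair

/-- Weyl's inequalities. Here `1 - 1 / p` stands for `1 / p'`, where `p'` is the exponent conjugate
to `p` (so `1 / p' = 0` for `p = 1`). -/
theorem theorem3p14 (n : ℕ) (V : Set (Rn n)) (S : Matrix (Fin n) (Fin n) ℝ)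
    (hSpos : S.PosDef) (hSV : IsCharacteristic S V) (hV : IsHomogeneousSet V)
    (r : ℝ) (hr : 1 ≤ r) :
    (∀ p q γ : ℝ, 1 ≤ p → p ≤ q →
      γ > coneSigma V + coneSigma (dualCone V) * (q * (1 - 1 / p)) + 2 * q - q / p →
      ∃ c : ℝ≥0, ∀ f : Rn n → ℝ≥0∞, AEMeasurable f (volume.restrict V) →
        (∫⁻ x in V, coneDelta V x ^ (γ - q) * weylOp V r f x ^ q) ^ (1 / q) ≤
          c * (∫⁻ x in V, f x ^ p * coneDelta V x ^ ((r - 1) * p + (γ + 1) * p / q - 1))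
            ^ (1 / p)) ∧
    (∀ p α : ℝ, 1 ≤ p →
      α > coneSigma (dualCone V) * (1 - 1 / p) + 2 - 1 / p →
      ∃ c : ℝ≥0, ∀ f : Rn n → ℝ≥0∞, AEMeasurable f (volume.restrict V) →
        essSup (fun x => coneDelta V x ^ (-1 + α) *
            weylOp V r (fun t => f t * coneDelta V t ^ (-α)) x) (volume.restrict V) ≤
          c * (∫⁻ x in V, f x ^ p * coneDelta V x ^ ((r - 1) * p - 1)) ^ (1 / p)) ∧
    (∀ α : ℝ, α > 2 + coneSigma (dualCone V) →
      ∃ c : ℝ≥0, ∀ f : Rn n → ℝ≥0∞, AEMeasurable f (volume.restrict V) →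
        essSup (fun x => coneDelta V x ^ (-1 + α) *
            weylOp V r (fun t => f t * coneDelta V t ^ (-α)) x) (volume.restrict V) ≤
          c * essSup (fun x => f x * coneDelta V x ^ (r - 1)) (volume.restrict V)) := by
  have h := hSV.isDualConePair hSpos hV
  exact ⟨fun p q γ hp hpq hγ => h.exists_weylOp_lintegral_le hr hp hpq hγ,
    fun p α hp hα => h.exists_weylOp_essSup_le_lintegral hr hp hα,
    fun α hα => (h.exists_weylOp_essSup_le_essSup hr hα).imp fun _ hc f _ => hc f⟩
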